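/- Let $R$ be a commutative ring and let $\mathbf{Sym}=R\langle S_1,S_2,\dots\rangle$ be the free associative algebra on the noncommutative complete symmetric functions $S_n=S_n(A)$, $n\ge 1$, graded by $\deg S_n=n$, with $S_0=1$. Let $\widehat{\mathbf{Sym}}=\prod_{n\ge0}\mathbf{Sym}_n$ be its completion for the grading, in which infinite sums converge degree by degree, and set $\sigma_1=\sum_{n\ge 0}S_n\in\widehat{\mathbf{Sym}}$. Let $F\mapsto F(-A)$ be the endomorphism of the algebra $\mathbf{Sym}$ with $S_n\mapsto S_n(-A)$, where $\sum_{n\ge 0}S_n(-A)=\sigma_1^{-1}$ and $S_n(-A)\in\mathbf{Sym}_n$; it preserves degrees and extends degree by degree to $\widehat{\mathbf{Sym}}$. (i) There is a unique $g\in\widehat{\mathbf{Sym}}$ (the noncommutative Lagrange series) with $g=\sum_{n\ge0}S_n\,g^n$. For every $k\in\mathbb Z$, positive, zero or negative, there is a unique invertible $g^{(k)}\in\widehat{\mathbf{Sym}}$ with $$g^{(k)}=\sum_{n\ge 0}S_n\left(g^{(k)}\right)^{kn}.$$ There is a unique $K=\sum_{n\ge0}K_n\in\widehat{\mathbf{Sym}}$,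 $K_n\in\mathbf{Sym}_n$ (the series of noncommutative free cumulants), with $\sigma_1=\sum_{n\ge0}K_n\,\sigma_1^n$. (ii) $g^{(1)}=g$ and $g^{(0)}=\sigma_1$. (iii) $g(-A)$ is invertible in $\widehat{\mathbf{Sym}}$, one has $$g(-A)^{-1}=\sum_{n\ge0}S_n\,g(-A)^n=\sum_{n\ge 0}S_n\left[g(-A)^{-1}\right]^{-n},$$ and $$g^{(-1)}=K=g(-A)^{-1}.$$ -/

import Mathlib

open Filter PowerSeries

namespace NCSF

/-- Noncommutative symmetric functions over `R`: the free associative algebra on the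
noncommutative complete functions `S₁, S₂, …`. -/
abbrev Sym (R : Type*) [CommRing R] : Type _ := FreeAlgebra R ℕ+

variable (R : Type*) [CommRing R]

/-- The complete functions `S n`, with `S 0 = 1`. -/
noncomputable def S (n : ℕ) : Sym R :=
  if h : 0 < n then FreeAlgebra.ι R (⟨n, h⟩ : ℕ+) else 1

/-- The homogeneous component `Sym_n`: the span of the products `S^I = S_{i₁} ⋯ S_{iᵣ}`
with `i₁ + ⋯ + iᵣ = n` (zero parts are allowed and harmless, as `S 0 = 1`). -/
def homogeneous (n : ℕ) : Submodule R (Sym R) :=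
  Submodule.span R {x | ∃ I : List ℕ, I.sum = n ∧ x = (I.map (S R)).prod}

theorem S_mem (n : ℕ) : S R n ∈ homogeneous R n :=
  Submodule.subset_span ⟨[n], by simp, by simp⟩

theorem one_mem_homogeneous : (1 : Sym R) ∈ homogeneous R 0 :=
  Submodule.subset_span ⟨[], by simp, by simp⟩

variable {R} in
theorem mul_mem_homogeneous {m n : ℕ} {x y : Sym R} (hx : x ∈ homogeneous R m)
    (hy : y ∈ homogeneous R n) : x * y ∈ homogeneous R (m + n) := by
  have h := Submodule.mul_mem_mul hx hy
  unfold homogeneous at h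
  rw [Submodule.span_mul_span] at h
  refine Submodule.span_mono ?_ h
  rintro _ ⟨_, ⟨I, rfl, rfl⟩, _, ⟨J, rfl, rfl⟩, rfl⟩
  exact ⟨I ++ J, by simp, by simp⟩

/-- The completion `∏ₙ Sym_n` of `Sym` for its grading.  A formal sum `F₀ + F₁ + F₂ + ⋯` with
`Fₙ ∈ Sym_n` is encoded as the power series `∑ Fₙ tⁿ` in a central variable `t`, so that the
product is the usual product of formal sums. -/
def Completion : Subalgebra R (Sym R)⟦X⟧ where
  carrier := {F | ∀ n, coeff n F ∈ homogeneous R n}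
  mul_mem' := by
    intro F G hF hG n
    rw [coeff_mul]
    refine Submodule.sum_mem _ fun p hp => ?_
    rw [← Finset.HasAntidiagonal.mem_antidiagonal.1 hp]
    exact mul_mem_homogeneous (hF _) (hG _)
  add_mem' := by
    intro F G hF hG n
    rw [map_add]
    exact Submodule.add_mem _ (hF n) (hG n)
  algebraMap_mem' := by
    intro r n
    have h : coeff n (algebraMap R (Sym R)⟦X⟧ r) = if n = 0 then algebraMap R (Sym R) r else 0 := by
      rw [PowerSeries.algebraMap_apply, PowerSeries.coeff_C]
    rw [h]
    split_ifs with hn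
    · subst hn
      rw [Algebra.algebraMap_eq_smul_one]
      exact Submodule.smul_mem _ _ (one_mem_homogeneous R)
    · exact Submodule.zero_mem _

variable {R}

/-- The homogeneous component `Fₙ` of `F = ∑ Fₙ`, as an element of the completion. -/
noncomputable def component (n : ℕ) (F : Completion R) : Completion R :=
  ⟨monomial n (coeff n F.1), fun m => by
    rw [coeff_monomial]
    split_ifs with h
    · subst h
      exact F.2 m
    · exact Submodule.zero_mem _⟩

/-- `F = ∑_{n ≥ 0} fₙ` in the completion: in each degree, the partial sums are
eventually equal to the component of `F`. -/
def HasGradedSum (f : ℕ → Completion R) (F : Completion R) : Prop :=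
  ∀ m : ℕ, ∀ᶠ N in atTop, component m (∑ n ∈ Finset.range N, f n) = component m F

variable (R)

/-- The series `σ₁ = ∑_{n ≥ 0} Sₙ`. -/
noncomputable def sigma : Completion R :=
  ⟨PowerSeries.mk (S R), fun n => by rw [coeff_mk]; exact S_mem R n⟩

/-- The complete function `Sₙ` as an element of the completion. -/
noncomputable def complete (n : ℕ) : Completion R := component n (sigma R)

/-- The functions `Sₙ(-A)`, that is, the homogeneous components of
`σ₁(-A) = σ₁(A)⁻¹ = (1 + S₁ + S₂ + ⋯)⁻¹`. -/
noncomputable def SNeg (n : ℕ) : Sym R :=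
  coeff n (invOfUnit (PowerSeries.mk (S R)) 1)

theorem SNeg_mem (n : ℕ) : SNeg R n ∈ homogeneous R n := by
  induction n using Nat.strong_induction_on with
  | _ n ih =>
    unfold SNeg
    rw [coeff_invOfUnit]
    split_ifs with h
    · subst h
      simpa using one_mem_homogeneous R
    · simp only [inv_one, Units.val_one, neg_mul, one_mul]
      refine Submodule.neg_mem _ (Submodule.sum_mem _ fun p hp => ?_)
      split_ifs with h2
      · rw [← Finset.HasAntidiagonal.mem_antidiagonal.1 hp, coeff_mk]
        exact mul_mem_homogeneous (S_mem R _) (ih _ h2)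
      · exact Submodule.zero_mem _

theorem SNeg_zero : SNeg R 0 = 1 := by
  unfold SNeg
  rw [coeff_invOfUnit]
  simp

/-- The series `σ₁(-A) = ∑ Sₙ(-A)`. -/
noncomputable def sigmaNeg : Completion R :=
  ⟨PowerSeries.mk (SNeg R), fun n => by rw [coeff_mk]; exact SNeg_mem R n⟩

theorem sigma_mul_sigmaNeg : sigma R * sigmaNeg R = 1 := by
  apply Subtype.ext
  have h : (PowerSeries.mk (SNeg R)) = invOfUnit (PowerSeries.mk (S R)) 1 := by
    ext n
    rw [coeff_mk]
    rfl
  change PowerSeries.mk (S R) * PowerSeries.mk (SNeg R) = 1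
  rw [h]
  apply mul_invOfUnit
  rw [← coeff_zero_eq_constantCoeff_apply, coeff_mk]
  simp [S]

/-- The algebra endomorphism `F ↦ F(-A)` of `Sym`, with `Sₙ ↦ Sₙ(-A)`. -/
noncomputable def negAlphabet : Sym R →ₐ[R] Sym R :=
  FreeAlgebra.lift R fun n : ℕ+ => SNeg R n

theorem negAlphabet_S (n : ℕ) : negAlphabet R (S R n) = SNeg R n := by
  unfold S
  split_ifs with h
  · exact FreeAlgebra.lift_ι_apply (R := R) (fun n : ℕ+ => SNeg R n) (⟨n, h⟩ : ℕ+)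
  · obtain rfl : n = 0 := by omega
    rw [map_one, SNeg_zero]

variable {R} in
theorem negAlphabet_mem {n : ℕ} {x : Sym R} (hx : x ∈ homogeneous R n) :
    negAlphabet R x ∈ homogeneous R n := by
  induction hx using Submodule.span_induction with
  | mem x h =>
    obtain ⟨I, rfl, rfl⟩ := h
    induction I with
    | nil => simpa using one_mem_homogeneous R
    | cons a I ih =>
      simp only [List.map_cons, List.prod_cons, List.sum_cons, map_mul, negAlphabet_S]
      exact mul_mem_homogeneous (SNeg_mem R a) ih
  | zero => simp
  | add x y _ _ hx hy =>
    rw [map_add]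
    exact Submodule.add_mem _ hx hy
  | smul r x _ hx =>
    rw [map_smul]
    exact Submodule.smul_mem _ r hx

/-- The endomorphism `F ↦ F(-A)` extended to the completion, degree by degree. -/
noncomputable def negHat : Completion R →ₐ[R] Completion R :=
  ((PowerSeries.mapAlgHom (negAlphabet R)).comp (Completion R).val).codRestrict (Completion R)
    fun F n => negAlphabet_mem (F.2 n)

theorem coeff_negHat (F : Completion R) (n : ℕ) :
    coeff n (negHat R F).1 = negAlphabet R (coeff n F.1) := rfl

variable {R}

/-- `g` is the noncommutative Lagrange series: `g = ∑_{n ≥ 0} Sₙ gⁿ`. -/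
def IsLagrange (g : Completion R) : Prop :=
  HasGradedSum (fun n => complete R n * g ^ n) g

/-- `g` is the `k`-Lagrange series `g^{(k)}`, for an integer `k` of any sign:
`g = ∑_{n ≥ 0} Sₙ g^{kn}`, where `g` is required to be invertible for the powers to make sense. -/
def IsKLagrange (k : ℤ) (g : (Completion R)ˣ) : Prop :=
  HasGradedSum (fun n => complete R n * ((g ^ (k * (n : ℤ)) : (Completion R)ˣ) : Completion R)) g

/-- `K = ∑ Kₙ` is the series of noncommutative free cumulants: `σ₁ = ∑_{n ≥ 0} Kₙ σ₁ⁿ`,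
where `Kₙ` is the homogeneous component of degree `n` of `K`. -/
def IsFreeCumulantSeries (K : Completion R) : Prop :=
  HasGradedSum (fun n => component n K * sigma R ^ n) (sigma R)

end NCSF

namespace NCSF

variable {R : Type*} [CommRing R]

/-! Write F∘v for the substitution `gradedSum F (v ^ ·)` = ∑ Fₙ vⁿ, which is linear in F but not
multiplicative. If G∘v = v, however, then (FG)∘v = (F∘v)v (`mul_gradedSum_pow`), and both halves of
the index −1 statement come from this rule. For σ∘g = g it gives 1 = (σ(-A)σ)∘g = (σ(-A)∘g)g;
applying F ↦ F(-A) yields (σ∘g(-A))g(-A) = 1, the equation for g(-A)⁻¹. For K∘σ = σ it gives K⁻ⁿ∘σ =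
σ⁻ⁿ, so ∑ Sₙ K⁻ⁿ and K both become σ under ∘σ; this substitution is injective
(`existsUnique_gradedSum_eq`), so K solves the equation of index −1. Uniqueness there identifies all
three series. Existence and uniqueness always come from `existsUnique_fixedPoint`: each equation
determines degree m from lower degrees. -/

/-! ### Graded sums in closed form. -/

theorem Completion.ext_coeff {F G : Completion R} (h : ∀ n, coeff n F.1 = coeff n G.1) : F = G :=
  Subtype.ext (PowerSeries.ext h)

/-- The graded sum `∑ Fₙ fₙ`, where `Fₙ` is the homogeneous component of degree `n` of `F`. -/
noncomputable def gradedSum (F : Completion R) (f : ℕ → Completion R) : Completion R :=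
  ⟨PowerSeries.mk fun m =>
      ∑ p ∈ Finset.HasAntidiagonal.antidiagonal m, coeff p.1 F.1 * coeff p.2 (f p.1).1, fun m => by
    rw [coeff_mk]
    refine Submodule.sum_mem _ fun p hp => ?_
    rw [← Finset.HasAntidiagonal.mem_antidiagonal.1 hp]
    exact mul_mem_homogeneous (F.2 _) ((f p.1).2 _)⟩

theorem coeff_gradedSum (F : Completion R) (f : ℕ → Completion R) (m : ℕ) :
    coeff m (gradedSum F f).1 =
      ∑ p ∈ Finset.HasAntidiagonal.antidiagonal m, coeff p.1 F.1 * coeff p.2 (f p.1).1 := by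
  rw [gradedSum, coeff_mk]

theorem component_eq_iff (m : ℕ) (F G : Completion R) :
    component m F = component m G ↔ coeff m F.1 = coeff m G.1 := by
  constructor
  · intro h
    have h' := congrArg (fun H : Completion R => coeff m H.1) h
    simpa [component] using h'
  · intro h
    apply Subtype.ext
    simp only [component, h]

theorem coeff_component_mul (n m : ℕ) (F G : Completion R) :
    coeff m (component n F * G).1 =
      if n ≤ m then coeff n F.1 * coeff (m - n) G.1 else 0 := by
  change coeff m (monomial n (coeff n F.1) * G.1) = _
  rw [coeff_mul]
  simp only [coeff_monomial, ite_mul, zero_mul]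
  split_ifs with h
  · rw [Finset.sum_eq_single (n, m - n)]
    · simp
    · rintro ⟨a, b⟩ hp hne
      rw [Finset.HasAntidiagonal.mem_antidiagonal] at hp
      rw [if_neg]
      rintro rfl
      exact hne (Prod.ext rfl (by simp only at hp ⊢; omega))
    · intro hn
      exact absurd (Finset.HasAntidiagonal.mem_antidiagonal.2 (by simp only; omega)) hn
  · refine Finset.sum_eq_zero fun p hp => if_neg ?_
    rw [Finset.HasAntidiagonal.mem_antidiagonal] at hp
    omega

theorem coeff_sum_component_mul (F : Completion R) (f : ℕ → Completion R) {m N : ℕ} (h : m < N) :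
    coeff m (∑ n ∈ Finset.range N, component n F * f n).1 = coeff m (gradedSum F f).1 := by
  rw [coeff_gradedSum, AddSubmonoidClass.coe_finsetSum, map_sum,
    Finset.Nat.sum_antidiagonal_eq_sum_range_succ
      (fun a b => coeff a F.1 * coeff b (f a).1)]
  simp only [coeff_component_mul]
  refine (Finset.sum_subset (Finset.range_subset_range.2 h) fun n _ hn => ?_).symm.trans
    (Finset.sum_congr rfl fun n hn => if_pos (by simpa [Nat.lt_succ_iff] using hn))
  exact if_neg (by simpa [Nat.lt_succ_iff] using hn)

/-- The term `component n F * f n` starts in degree n, so the coefficient of degree m is constant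
once more than m terms are summed. Convergence becomes an equation. -/
theorem hasGradedSum_iff (F G : Completion R) (f : ℕ → Completion R) :
    HasGradedSum (fun n => component n F * f n) G ↔ gradedSum F f = G := by
  simp only [HasGradedSum, component_eq_iff]
  constructor
  · intro h
    refine Completion.ext_coeff fun m => ?_
    obtain ⟨N, hN, hm⟩ := ((h m).and (eventually_gt_atTop m)).exists
    rw [← hN, coeff_sum_component_mul F f hm]
  · rintro rfl m
    filter_upwards [eventually_gt_atTop m] with N hN using coeff_sum_component_mul F f hN

theorem isLagrange_iff (g : Completion R) :
    IsLagrange g ↔ gradedSum (sigma R) (fun n => g ^ n) = g :=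
  hasGradedSum_iff _ _ _

theorem isKLagrange_iff (k : ℤ) (g : (Completion R)ˣ) :
    IsKLagrange k g ↔ gradedSum (sigma R)
      (fun n => ((g ^ (k * (n : ℤ)) : (Completion R)ˣ) : Completion R)) = g :=
  hasGradedSum_iff _ _ _

theorem isFreeCumulantSeries_iff (K : Completion R) :
    IsFreeCumulantSeries K ↔ gradedSum K (fun n => sigma R ^ n) = sigma R :=
  hasGradedSum_iff _ _ _

/-! ### Algebra of substitution. -/

theorem gradedSum_const (F G : Completion R) : gradedSum F (fun _ => G) = F * G := by
  refine Completion.ext_coeff fun m => ?_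
  rw [coeff_gradedSum]
  exact (coeff_mul m F.1 G.1).symm

/-- Associativity: the part of degree a + b of ∑ Fₐ fₐ is assembled from Fₐ times the degree b part
of fₐ, hence the shifted index in `v (a + b)`. -/
theorem gradedSum_gradedSum (F : Completion R) (f v : ℕ → Completion R) :
    gradedSum (gradedSum F f) v = gradedSum F (fun a => gradedSum (f a) fun b => v (a + b)) := by
  refine Completion.ext_coeff fun m => ?_
  simp only [coeff_gradedSum, Finset.sum_mul, Finset.mul_sum]
  rw [Finset.sum_sigma', Finset.sum_sigma']
  refine Finset.sum_nbij' (fun x => ⟨(x.2.1, x.2.2 + x.1.2), (x.2.2, x.1.2)⟩)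
    (fun x => ⟨(x.1.1 + x.2.1, x.2.2), (x.1.1, x.2.1)⟩) ?_ ?_ ?_ ?_ ?_
  all_goals
    rintro ⟨⟨a, b⟩, ⟨c, d⟩⟩ h
    simp only [Finset.mem_sigma, Finset.HasAntidiagonal.mem_antidiagonal] at h
    obtain ⟨h, rfl⟩ := h
  · simp only [Finset.mem_sigma, Finset.HasAntidiagonal.mem_antidiagonal, and_true]
    omega
  · simp only [Finset.mem_sigma, Finset.HasAntidiagonal.mem_antidiagonal, and_true]
    omega
  · rfl
  · rfl
  · exact mul_assoc _ _ _

theorem gradedSum_mul (F w : Completion R) (f : ℕ → Completion R) :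
    gradedSum F f * w = gradedSum F (fun n => f n * w) := by
  rw [← gradedSum_const, gradedSum_gradedSum]
  simp only [gradedSum_const]

theorem mul_gradedSum_pow (F G v : Completion R) (h : gradedSum G (fun n => v ^ n) = v) :
    gradedSum (F * G) (fun n => v ^ n) = gradedSum F (fun n => v ^ n) * v := by
  rw [← gradedSum_const F G, gradedSum_gradedSum, gradedSum_mul]
  congr 1
  funext a
  have h1 : (fun b => v ^ (a + b)) = fun b => v ^ b * v ^ a := by
    funext b
    rw [add_comm, pow_add]
  -- The inner sum is (∑ G_b v^b) v^a = v · v^a; powers of v commute, although F, G and v need not.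
  rw [h1, ← gradedSum_mul, h, ← pow_succ', pow_succ]

theorem coeff_zero_one : coeff 0 (1 : Completion R).1 = 1 := by
  change coeff 0 (1 : (Sym R)⟦X⟧) = 1
  simp

theorem gradedSum_one (f : ℕ → Completion R) : gradedSum 1 f = f 0 := by
  refine Completion.ext_coeff fun m => ?_
  rw [coeff_gradedSum, Finset.sum_eq_single (0, m)]
  · rw [coeff_zero_one, one_mul]
  · rintro ⟨a, b⟩ hp hne
    rw [Finset.HasAntidiagonal.mem_antidiagonal] at hp
    have ha : a ≠ 0 := by
      rintro rfl
      exact hne (Prod.ext rfl (by simpa using hp))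
    change coeff a (1 : (Sym R)⟦X⟧) * _ = 0
    rw [coeff_one, if_neg ha, zero_mul]
  · intro hn
    exact absurd (Finset.HasAntidiagonal.mem_antidiagonal.2 (zero_add m)) hn

theorem negHat_gradedSum (F : Completion R) (f : ℕ → Completion R) :
    negHat R (gradedSum F f) = gradedSum (negHat R F) (fun n => negHat R (f n)) := by
  refine Completion.ext_coeff fun m => ?_
  simp only [coeff_gradedSum, coeff_negHat, map_sum, map_mul]

theorem coeff_sigma (n : ℕ) : coeff n (sigma R).1 = S R n := by
  rw [sigma, coeff_mk]

theorem S_zero : S R 0 = 1 := by simp [S]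

theorem negHat_sigma : negHat R (sigma R) = sigmaNeg R := by
  refine Completion.ext_coeff fun m => ?_
  rw [coeff_negHat, coeff_sigma, negAlphabet_S]
  exact (coeff_mk _ _).symm

/-! ### Agreement up to a degree and fixed points. -/

/-- Two series agree in all degrees less than `m`. -/
def Agree (m : ℕ) (F G : Completion R) : Prop := ∀ j < m, coeff j F.1 = coeff j G.1

theorem Agree.rfl {m : ℕ} {F : Completion R} : Agree m F F := fun _ _ => Eq.refl _

theorem Agree.symm {m : ℕ} {F G : Completion R} (h : Agree m F G) : Agree m G F :=
  fun j hj => (h j hj).symm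

theorem Agree.gradedSum {m : ℕ} {F G : Completion R} (h : Agree m F G)
    {f g : ℕ → Completion R} (hfg : ∀ n, Agree m (f n) (g n)) :
    Agree m (gradedSum F f) (gradedSum G g) := by
  intro j hj
  rw [coeff_gradedSum, coeff_gradedSum]
  refine Finset.sum_congr (Eq.refl _) fun p hp => ?_
  rw [Finset.HasAntidiagonal.mem_antidiagonal] at hp
  rw [h p.1 (by omega), hfg p.1 p.2 (by omega)]

theorem Agree.mul {m : ℕ} {F G F' G' : Completion R} (h : Agree m F G) (h' : Agree m F' G') :
    Agree m (F * F') (G * G') := by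
  rw [← gradedSum_const, ← gradedSum_const]
  exact h.gradedSum fun _ => h'

theorem Agree.pow {m : ℕ} {F G : Completion R} (h : Agree m F G) (n : ℕ) :
    Agree m (F ^ n) (G ^ n) := by
  induction n with
  | zero => simpa using Agree.rfl
  | succ n ih => simpa only [pow_succ] using ih.mul h

theorem Agree.units_inv {m : ℕ} {u v : (Completion R)ˣ} (h : Agree m (u : Completion R) v) :
    Agree m ((u⁻¹ : (Completion R)ˣ) : Completion R) (v⁻¹ : (Completion R)ˣ) := by
  -- Compare u⁻¹uv⁻¹ with u⁻¹vv⁻¹.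
  have h1 := ((Agree.rfl (F := ((u⁻¹ : (Completion R)ˣ) : Completion R))).mul h).mul
    (Agree.rfl (F := ((v⁻¹ : (Completion R)ˣ) : Completion R)))
  rw [Units.inv_mul, one_mul, mul_assoc, Units.mul_inv, mul_one] at h1
  exact h1.symm

theorem Agree.units_zpow {m : ℕ} {u v : (Completion R)ˣ} (h : Agree m (u : Completion R) v)
    (k : ℤ) : Agree m ((u ^ k : (Completion R)ˣ) : Completion R) (v ^ k : (Completion R)ˣ) := by
  cases k with
  | ofNat n => simpa using h.pow n
  | negSucc n =>
    simp only [zpow_negSucc]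
    refine Agree.units_inv ?_
    simpa using h.pow (n + 1)

/-- A map that gains one degree of agreement has a unique fixed point. -/
theorem existsUnique_fixedPoint (Φ : Completion R → Completion R)
    (hΦ : ∀ m F G, Agree m F G → Agree (m + 1) (Φ F) (Φ G)) : ∃! F, Φ F = F := by
  have hiter : ∀ n, Agree n (Φ^[n] 0) (Φ^[n + 1] 0) := by
    intro n
    induction n with
    | zero => exact fun j hj => absurd hj (Nat.not_lt_zero j)
    | succ n ih =>
      rw [Function.iterate_succ_apply', Function.iterate_succ_apply' Φ (n + 1)]
      exact hΦ n _ _ ih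
  have hstab : ∀ j n, j + 1 ≤ n → coeff j (Φ^[n] 0).1 = coeff j (Φ^[j + 1] 0).1 := by
    intro j n hn
    induction n, hn using Nat.le_induction with
    | base => rfl
    | succ n hn ih => rw [← ih, hiter n j hn]
  -- Diagonal limit: the coefficient of degree j no longer changes from iterate j + 1 on.
  let L : Completion R := ⟨PowerSeries.mk fun j => coeff j (Φ^[j + 1] 0).1, fun j => by
    rw [coeff_mk]
    exact (Φ^[j + 1] 0).2 j⟩
  have hL : ∀ j, coeff j L.1 = coeff j (Φ^[j + 1] 0).1 := fun j => by
    simp only [L, coeff_mk]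
  refine ⟨L, Completion.ext_coeff fun m => ?_, fun G hG => Completion.ext_coeff fun m => ?_⟩
  · have h : Agree m L (Φ^[m] 0) := fun j hj => by rw [hL, hstab j m hj]
    rw [hΦ m _ _ h m (Nat.lt_succ_self m), hL, Function.iterate_succ_apply']
  · have h : ∀ n, Agree n G (Φ^[n] 0) := by
      intro n
      induction n with
      | zero => exact fun j hj => absurd hj (Nat.not_lt_zero j)
      | succ n ih =>
        rw [Function.iterate_succ_apply', ← hG]
        exact hΦ n _ _ ih
    rw [hL, h (m + 1) m (Nat.lt_succ_self m)]

/-- The component of F in the new degree m could only meet the constant term of `f m`, which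
vanishes. -/
theorem agree_gradedSum_left {m : ℕ} {F G : Completion R} (h : Agree m F G)
    {f : ℕ → Completion R} (hf : ∀ n, coeff 0 (f n).1 = 0) :
    Agree (m + 1) (gradedSum F f) (gradedSum G f) := by
  intro j hj
  rw [coeff_gradedSum, coeff_gradedSum]
  refine Finset.sum_congr rfl fun p hp => ?_
  rw [Finset.HasAntidiagonal.mem_antidiagonal] at hp
  rcases Nat.eq_zero_or_pos p.2 with h0 | h0
  · rw [h0, hf, mul_zero, mul_zero]
  · rw [h p.1 (by omega)]

/-- For n ≥ 1 the factor Fₙ raises the degree, which gains the extra degree; the term n = 0 has no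
such shift and must be fixed by `h0`. -/
theorem agree_gradedSum_right {m : ℕ} (F : Completion R) {f g : ℕ → Completion R}
    (h0 : f 0 = g 0) (h : ∀ n, Agree m (f n) (g n)) :
    Agree (m + 1) (gradedSum F f) (gradedSum F g) := by
  intro j hj
  rw [coeff_gradedSum, coeff_gradedSum]
  refine Finset.sum_congr rfl fun p hp => ?_
  rw [Finset.HasAntidiagonal.mem_antidiagonal] at hp
  rcases Nat.eq_zero_or_pos p.1 with hp0 | hp0
  · rw [hp0, h0]
  · rw [h p.1 p.2 (by omega)]

/-! ### Constant terms and invertibility. -/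

theorem coeff_zero_mul (F G : Completion R) :
    coeff 0 (F * G).1 = coeff 0 F.1 * coeff 0 G.1 := by
  change coeff 0 (F.1 * G.1) = _
  simp

theorem coeff_zero_pow {F : Completion R} (h : coeff 0 F.1 = 1) (n : ℕ) :
    coeff 0 (F ^ n).1 = 1 := by
  induction n with
  | zero => simp
  | succ n ih => rw [pow_succ, coeff_zero_mul, ih, h, one_mul]

theorem coeff_zero_gradedSum (F : Completion R) (f : ℕ → Completion R) :
    coeff 0 (gradedSum F f).1 = coeff 0 F.1 * coeff 0 (f 0).1 := by
  rw [coeff_gradedSum]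
  simp

/-- A series with constant term `1` has a left inverse in the completion. -/
theorem exists_left_inverse {F : Completion R} (h : coeff 0 F.1 = 1) :
    ∃ G : Completion R, coeff 0 G.1 = 1 ∧ G * F = 1 := by
  -- GF = 1 rewritten as G = 1 − G(F − 1), where F − 1 has no constant term.
  obtain ⟨G, hG, -⟩ := existsUnique_fixedPoint (fun G => 1 - G * (F - 1)) (by
    intro m A B hAB
    have h0 : coeff 0 (F - 1).1 = 0 := by
      change coeff 0 (F.1 - (1 : Completion R).1) = 0
      rw [map_sub, h, coeff_zero_one, sub_self]
    have h1 := agree_gradedSum_left hAB (f := fun _ => F - 1) fun _ => h0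
    rw [gradedSum_const, gradedSum_const] at h1
    intro j hj
    change coeff j ((1 : Completion R).1 - (A * (F - 1)).1) =
      coeff j ((1 : Completion R).1 - (B * (F - 1)).1)
    rw [map_sub, map_sub, h1 j hj])
  have hGF : G * F = 1 := by
    simp only [mul_sub, mul_one] at hG
    have h2 := sub_eq_zero.2 hG
    rw [show 1 - (G * F - G) - G = 1 - G * F by abel, sub_eq_zero] at h2
    exact h2.symm
  refine ⟨G, ?_, hGF⟩
  have h3 := coeff_zero_mul G F
  rw [hGF, h, mul_one, coeff_zero_one] at h3
  exact h3.symm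

/-- The left inverse again has constant term 1, so it has its own left inverse, which must be F. -/
theorem isUnit_of_coeff_zero {F : Completion R} (h : coeff 0 F.1 = 1) : IsUnit F := by
  obtain ⟨G, hG, hGF⟩ := exists_left_inverse h
  obtain ⟨H, -, hHG⟩ := exists_left_inverse hG
  have hHF : H = F := by
    rw [← mul_one H, ← hGF, ← mul_assoc, hHG, one_mul]
  exact ⟨⟨F, G, by rw [← hHF, hHG], hGF⟩, rfl⟩

/-- The unit obtained from a series by replacing its constant term with `1`. -/
noncomputable def normalizedUnit (F : Completion R) : (Completion R)ˣ :=
  (isUnit_of_coeff_zero (F := F + component 0 (1 - F)) (by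
    change coeff 0 (F.1 + monomial 0 (coeff 0 ((1 : Completion R).1 - F.1))) = 1
    rw [map_add, coeff_monomial_same, map_sub, coeff_zero_one, add_sub_cancel])).unit

theorem coeff_normalizedUnit (F : Completion R) (n : ℕ) :
    coeff n (normalizedUnit F : Completion R).1 = if n = 0 then 1 else coeff n F.1 := by
  change coeff n (F.1 + monomial 0 (coeff 0 ((1 : Completion R).1 - F.1))) = _
  rw [map_add, coeff_monomial, map_sub, coeff_zero_one]
  split_ifs with h
  · rw [h, add_sub_cancel]
  · rw [add_zero]

theorem normalizedUnit_eq {F : Completion R} (h : coeff 0 F.1 = 1) :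
    (normalizedUnit F : Completion R) = F := by
  refine Completion.ext_coeff fun n => ?_
  rw [coeff_normalizedUnit]
  split_ifs with hn
  · rw [hn, h]
  · rfl

theorem Agree.normalizedUnit {m : ℕ} {F G : Completion R} (h : Agree m F G) :
    Agree m (normalizedUnit F : Completion R) (normalizedUnit G) := by
  intro j hj
  rw [coeff_normalizedUnit, coeff_normalizedUnit, h j hj]

/-! ### Existence and uniqueness of the series. -/

theorem coeff_zero_of_isKLagrange {k : ℤ} {g : (Completion R)ˣ} (h : IsKLagrange k g) :
    coeff 0 (g : Completion R).1 = 1 := by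
  rw [isKLagrange_iff] at h
  rw [← h, coeff_zero_gradedSum, coeff_sigma, S_zero]
  simp

theorem coeff_zero_of_isLagrange {g : Completion R} (h : IsLagrange g) :
    coeff 0 g.1 = 1 := by
  rw [isLagrange_iff] at h
  rw [← h, coeff_zero_gradedSum, coeff_sigma, S_zero]
  simp

theorem existsUnique_isKLagrange (k : ℤ) : ∃! g : (Completion R)ˣ, IsKLagrange k g := by
  -- `normalizedUnit` makes the map total, since negative powers need a unit. It is harmless: any
  -- solution has constant term 1, where normalization changes nothing.
  obtain ⟨F, hF, huniq⟩ := existsUnique_fixedPoint (R := R)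
    (fun F => gradedSum (sigma R) fun n =>
      ((normalizedUnit F ^ (k * (n : ℤ)) : (Completion R)ˣ) : Completion R))
    (fun m A B h => agree_gradedSum_right _ (by simp) fun n => h.normalizedUnit.units_zpow _)
  have hF0 : coeff 0 F.1 = 1 := by
    rw [← hF, coeff_zero_gradedSum, coeff_sigma, S_zero]
    simp
  refine ⟨normalizedUnit F, ?_, fun u hu => ?_⟩
  · refine (isKLagrange_iff _ _).2 ?_
    rw [normalizedUnit_eq hF0]
    exact hF
  · have hu0 := coeff_zero_of_isKLagrange hu
    have hu1 : normalizedUnit (u : Completion R) = u := Units.ext (normalizedUnit_eq hu0)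
    replace hu := (isKLagrange_iff _ _).1 hu
    refine Units.ext ?_
    rw [normalizedUnit_eq hF0]
    apply huniq
    simp only [hu1]
    exact hu

theorem isKLagrange_one_iff (g : (Completion R)ˣ) :
    IsKLagrange 1 g ↔ IsLagrange (g : Completion R) := by
  simp [isKLagrange_iff, isLagrange_iff]

theorem existsUnique_isLagrange : ∃! g : Completion R, IsLagrange g := by
  obtain ⟨u, hu, huniq⟩ := existsUnique_isKLagrange (R := R) 1
  refine ⟨u, (isKLagrange_one_iff u).1 hu, fun g hg => ?_⟩
  obtain ⟨v, rfl⟩ := isUnit_of_coeff_zero (coeff_zero_of_isLagrange hg)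
  rw [huniq v ((isKLagrange_one_iff v).2 hg)]

theorem coeff_zero_sigma : coeff 0 (sigma R).1 = 1 := by
  rw [coeff_sigma, S_zero]

/-- Every series is uniquely of the form `∑ Fₙ vₙ`, if all `vₙ` have constant term `1`. -/
theorem existsUnique_gradedSum_eq (G : Completion R) {v : ℕ → Completion R}
    (hv : ∀ n, coeff 0 (v n).1 = 1) : ∃! F, gradedSum F v = G := by
  have hsub : ∀ F, gradedSum F (fun n => v n - 1) = gradedSum F v - F := by
    intro F
    have h1 : gradedSum F v - F = gradedSum F v - gradedSum F (fun _ => 1) := by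
      rw [gradedSum_const, mul_one]
    rw [h1]
    refine Completion.ext_coeff fun m => ?_
    change _ = coeff m ((gradedSum F v).1 - (gradedSum F fun _ => 1).1)
    rw [map_sub, coeff_gradedSum, coeff_gradedSum, coeff_gradedSum, ← Finset.sum_sub_distrib]
    refine Finset.sum_congr rfl fun p _ => ?_
    rw [← mul_sub, ← map_sub]
    rfl
  -- Subtracting 1 from each vₙ isolates F and leaves a sum whose factors have no constant term.
  have hiff : ∀ F, G - gradedSum F (fun n => v n - 1) = F ↔ gradedSum F v = G := by
    intro F
    rw [hsub, ← sub_eq_zero, show G - (gradedSum F v - F) - F = G - gradedSum F v by abel,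
      sub_eq_zero, eq_comm]
  have h := existsUnique_fixedPoint (fun F => G - gradedSum F (fun n => v n - 1)) (by
    intro m A B hAB
    have h1 := agree_gradedSum_left hAB (f := fun n => v n - 1) (by
      intro n
      change coeff 0 ((v n).1 - (1 : Completion R).1) = 0
      rw [map_sub, hv, coeff_zero_one, sub_self])
    intro j hj
    change coeff j (G.1 - (gradedSum A _).1) = coeff j (G.1 - (gradedSum B _).1)
    rw [map_sub, map_sub, h1 j hj])
  simpa only [hiff] using h

theorem existsUnique_isFreeCumulantSeries : ∃! K : Completion R, IsFreeCumulantSeries K := by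
  simpa only [isFreeCumulantSeries_iff] using
    existsUnique_gradedSum_eq (sigma R) fun n => coeff_zero_pow coeff_zero_sigma n

/-! ### The members of index 0 and −1. -/

theorem eq_sigma_of_isKLagrange_zero {g : (Completion R)ˣ} (h : IsKLagrange 0 g) :
    (g : Completion R) = sigma R := by
  rw [isKLagrange_iff] at h
  rw [← h]
  simp [gradedSum_const]

theorem sigmaNeg_mul_sigma : sigmaNeg R * sigma R = 1 := by
  obtain ⟨G, -, hG⟩ := exists_left_inverse (coeff_zero_sigma (R := R))
  have h : G = sigmaNeg R := by
    rw [← mul_one G, ← sigma_mul_sigmaNeg, ← mul_assoc, hG, one_mul]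
  rw [← h, hG]

/-- F ↦ F(-A) sends σ to its inverse, hence that inverse back to σ. -/
theorem negHat_sigmaNeg : negHat R (sigmaNeg R) = sigma R := by
  have h := congrArg (negHat R) (sigmaNeg_mul_sigma (R := R))
  rw [map_mul, map_one, negHat_sigma] at h
  rw [← mul_one (negHat R (sigmaNeg R)), ← sigmaNeg_mul_sigma, ← mul_assoc, h, one_mul]

theorem gradedSum_sigmaNeg_mul {g : Completion R} (h : IsLagrange g) :
    gradedSum (sigmaNeg R) (fun n => g ^ n) * g = 1 := by
  rw [isLagrange_iff] at h
  rw [← mul_gradedSum_pow _ _ _ h, sigmaNeg_mul_sigma, gradedSum_one, pow_zero]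

theorem gradedSum_negHat_mul {g : Completion R} (h : IsLagrange g) :
    gradedSum (sigma R) (fun n => negHat R g ^ n) * negHat R g = 1 := by
  have h1 := congrArg (negHat R) (gradedSum_sigmaNeg_mul h)
  simpa only [map_mul, map_one, negHat_gradedSum, negHat_sigmaNeg, map_pow] using h1

/-- The series of free cumulants satisfies the equation of index `-1`. -/
theorem isKLagrange_neg_one_of_isFreeCumulantSeries {K : (Completion R)ˣ}
    (h : IsFreeCumulantSeries (K : Completion R)) : IsKLagrange (-1) K := by
  rw [isFreeCumulantSeries_iff] at h
  -- This is K⁻ⁿ∘σ = σ⁻ⁿ: by the product rule, splitting off a factor K on the right splits off a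
  -- factor σ.
  have hpow : ∀ n : ℕ, gradedSum ((K⁻¹ ^ n : (Completion R)ˣ) : Completion R)
      (fun j => sigma R ^ j) * sigma R ^ n = 1 := by
    intro n
    induction n with
    | zero => simp [gradedSum_one]
    | succ n ih =>
      rw [pow_succ' (sigma R), ← mul_assoc, ← mul_gradedSum_pow _ _ _ h, ← Units.val_mul,
        pow_succ, mul_assoc, inv_mul_cancel, mul_one, ih]
  rw [isKLagrange_iff]
  -- Both sides of the equation for K are compared after the injective substitution ∘σ.
  obtain ⟨_, -, huniq⟩ := existsUnique_gradedSum_eq (sigma R)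
    fun n => coeff_zero_pow (coeff_zero_sigma (R := R)) n
  refine (huniq _ ?_).trans (huniq _ h).symm
  simp only
  rw [gradedSum_gradedSum]
  have h1 : ∀ a : ℕ, gradedSum ((K ^ ((-1 : ℤ) * (a : ℤ)) : (Completion R)ˣ) : Completion R)
      (fun b => sigma R ^ (a + b)) = 1 := by
    intro a
    rw [← hpow a, gradedSum_mul, zpow_mul, zpow_neg_one, zpow_natCast]
    simp only [← pow_add, add_comm a]
  simp only [h1, gradedSum_const, mul_one]

theorem coeff_zero_of_isFreeCumulantSeries {K : Completion R} (h : IsFreeCumulantSeries K) :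
    coeff 0 K.1 = 1 := by
  rw [isFreeCumulantSeries_iff] at h
  rw [← coeff_zero_sigma, ← h, coeff_zero_gradedSum, pow_zero, coeff_zero_one, mul_one]

end NCSF

theorem mainTheorem8 (R : Type*) [CommRing R] :
    -- the series exist and are uniquely determined by their equations
    (∃! g : NCSF.Completion R, NCSF.IsLagrange g) ∧
    (∀ k : ℤ, ∃! g : (NCSF.Completion R)ˣ, NCSF.IsKLagrange k g) ∧
    (∃! K : NCSF.Completion R, NCSF.IsFreeCumulantSeries K) ∧
    -- the Lagrange series is the member of index one of the hierarchy
    (∀ g : (NCSF.Completion R)ˣ, NCSF.IsKLagrange 1 g ↔ NCSF.IsLagrange (g : NCSF.Completion R)) ∧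
    -- the member of index zero is the series of complete functions
    (∀ g₀ : (NCSF.Completion R)ˣ, NCSF.IsKLagrange 0 g₀ →
      (g₀ : NCSF.Completion R) = NCSF.sigma R) ∧
    -- the member of index minus one, the free cumulants and the inverse of `g(-A)` coincide
    (∀ (g : NCSF.Completion R) (g₁ : (NCSF.Completion R)ˣ) (K : NCSF.Completion R),
      NCSF.IsLagrange g → NCSF.IsKLagrange (-1) g₁ → NCSF.IsFreeCumulantSeries K →
      (g₁ : NCSF.Completion R) = K ∧
      ∃ u : (NCSF.Completion R)ˣ, (u : NCSF.Completion R) = NCSF.negHat R g ∧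
        K = ((u⁻¹ : (NCSF.Completion R)ˣ) : NCSF.Completion R) ∧
        NCSF.HasGradedSum (fun n => NCSF.complete R n * NCSF.negHat R g ^ n)
          ((u⁻¹ : (NCSF.Completion R)ˣ) : NCSF.Completion R) ∧
        NCSF.IsKLagrange (-1) u⁻¹) := by
  refine ⟨NCSF.existsUnique_isLagrange, NCSF.existsUnique_isKLagrange,
    NCSF.existsUnique_isFreeCumulantSeries, NCSF.isKLagrange_one_iff,
    fun g₀ => NCSF.eq_sigma_of_isKLagrange_zero, fun g g₁ K hg hg₁ hK => ?_⟩
  have hmul := NCSF.gradedSum_negHat_mul hg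
  have hg0 : coeff 0 (NCSF.negHat R g).1 = 1 := by
    rw [NCSF.coeff_negHat, NCSF.coeff_zero_of_isLagrange hg, map_one]
  obtain ⟨u, hu⟩ := NCSF.isUnit_of_coeff_zero hg0
  obtain ⟨k, rfl⟩ := NCSF.isUnit_of_coeff_zero (NCSF.coeff_zero_of_isFreeCumulantSeries hK)
  have huinv : NCSF.gradedSum (NCSF.sigma R) (fun n => NCSF.negHat R g ^ n) =
      ((u⁻¹ : (NCSF.Completion R)ˣ) : NCSF.Completion R) := by
    rw [← hu] at hmul ⊢
    exact (Units.mul_eq_one_iff_eq_inv).1 hmul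
  have hk := NCSF.isKLagrange_neg_one_of_isFreeCumulantSeries hK
  -- Since (u⁻¹)⁻ⁿ = uⁿ, the formula for u⁻¹ is already the equation of index −1.
  have hu1 : NCSF.IsKLagrange (-1) u⁻¹ := by
    rw [NCSF.isKLagrange_iff, ← huinv, ← hu]
    simp
  have huniq {v w : (NCSF.Completion R)ˣ} (hv : NCSF.IsKLagrange (-1) v)
      (hw : NCSF.IsKLagrange (-1) w) : v = w :=
    (NCSF.existsUnique_isKLagrange (-1)).unique hv hw
  exact ⟨congrArg Units.val (huniq hg₁ hk), u, hu, congrArg Units.val (huniq hk hu1),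
    (NCSF.hasGradedSum_iff _ _ _).2 huinv, hu1⟩
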